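/- Let $K$ be a field of characteristic zero and let $n,m\ge 0$ be integers with $s:=2n+m\ge 1$. Let $A_n$ be the $n$-th Weyl algebra over $K$, generated by $q_1,\dots,q_n,p_1,\dots,p_n$ subject to $[p_i,q_j]=\delta_{ij}$ and $[q_i,q_j]=[p_i,p_j]=0$ for all $i,j$, and let $P_m=K[x_{2n+1},\dots,x_{2n+m}]$ be the polynomial algebra in $m$ variables. In $A_n\otimes_K P_m$ put $x_i:=q_i$ and $x_{n+i}:=p_i$ for $1\le i\le n$. The ordered monomials $x^\alpha=x_1^{\alpha_1}\cdots x_s^{\alpha_s}$, $\alpha\in\mathbb{N}^s$, form a $K$-basis of $A_n\otimes_K P_m$. For a nonzero $a=\sum_\alpha\lambda_\alpha x^\alpha$ with $\lambda_\alpha\in K$, let $\deg a:=\max\{\alpha_1+\cdots+\alpha_s : \lambda_\alpha\neq 0\}$, and for a $K$-algebra automorphism $\sigma$ of $A_n\otimes_K P_m$ let $\deg\sigma:=\max\{\deg\sigma(x_i) : 1\le i\le s\}$. Then, for every $\sigma\in\mathrm{Aut}_K(A_n\otimes_K P_m)$, $$\deg\sigma^{-1}\le(\deg\sigma)^{2n+m-1}.$$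 -/

import Mathlib

open scoped TensorProduct

noncomputable section

namespace WeylPoly

/-- The defining relations of the `n`-th Weyl algebra on the free algebra with generators
`q i` (the left copy of `Fin n`) and `p i` (the right copy):
`[p i, q j] = δ i j` and `[q i, q j] = [p i, p j] = 0`. -/
inductive WeylRel (K : Type*) [CommRing K] (n : ℕ) :
    FreeAlgebra K (Fin n ⊕ Fin n) → FreeAlgebra K (Fin n ⊕ Fin n) → Prop
  | pq (i j : Fin n) : WeylRel K n
      (FreeAlgebra.ι K (Sum.inr i) * FreeAlgebra.ι K (Sum.inl j)
        - FreeAlgebra.ι K (Sum.inl j) * FreeAlgebra.ι K (Sum.inr i))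
      (if i = j then 1 else 0)
  | qq (i j : Fin n) : WeylRel K n
      (FreeAlgebra.ι K (Sum.inl i) * FreeAlgebra.ι K (Sum.inl j)
        - FreeAlgebra.ι K (Sum.inl j) * FreeAlgebra.ι K (Sum.inl i)) 0
  | pp (i j : Fin n) : WeylRel K n
      (FreeAlgebra.ι K (Sum.inr i) * FreeAlgebra.ι K (Sum.inr j)
        - FreeAlgebra.ι K (Sum.inr j) * FreeAlgebra.ι K (Sum.inr i)) 0

/-- The `n`-th Weyl algebra over `K`, by generators and relations. -/
abbrev WeylAlgebra (K : Type*) [CommRing K] (n : ℕ) : Type _ := RingQuot (WeylRel K n)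

variable (K : Type*) [CommRing K] (n m : ℕ)

/-- The generator `q i` of the Weyl algebra. -/
def q (i : Fin n) : WeylAlgebra K n :=
  RingQuot.mkAlgHom K (WeylRel K n) (FreeAlgebra.ι K (Sum.inl i))

/-- The generator `p i` of the Weyl algebra. -/
def p (i : Fin n) : WeylAlgebra K n :=
  RingQuot.mkAlgHom K (WeylRel K n) (FreeAlgebra.ι K (Sum.inr i))

/-- The algebra `A_n ⊗ P_m`. -/
abbrev WeylPolyAlgebra : Type _ := WeylAlgebra K n ⊗[K] MvPolynomial (Fin m) K

/-- The index set, with `s = 2 * n + m` elements, of the canonical generators of `A_n ⊗ P_m`. -/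
abbrev Idx : Type := (Fin n ⊕ Fin n) ⊕ Fin m

/-- The canonical generators `x_1, …, x_s` of `A_n ⊗ P_m`, namely
`q_1, …, q_n, p_1, …, p_n` and then the polynomial variables. -/
def gen : Idx n m → WeylPolyAlgebra K n m
  | Sum.inl (Sum.inl i) => q K n i ⊗ₜ 1
  | Sum.inl (Sum.inr i) => p K n i ⊗ₜ 1
  | Sum.inr j => 1 ⊗ₜ MvPolynomial.X j

/-- The ordered monomial `x ^ α = x_1 ^ α_1 * ⋯ * x_s ^ α_s`. -/
def stdMonomial (α : Idx n m →₀ ℕ) : WeylPolyAlgebra K n m :=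
  (List.ofFn fun i : Fin n => gen K n m (Sum.inl (Sum.inl i)) ^ α (Sum.inl (Sum.inl i))).prod
    * (List.ofFn fun i : Fin n => gen K n m (Sum.inl (Sum.inr i)) ^ α (Sum.inl (Sum.inr i))).prod
    * (List.ofFn fun j : Fin m => gen K n m (Sum.inr j) ^ α (Sum.inr j)).prod

/-! Helper facts: the ordered monomials form a `K`-basis. -/

theorem p_mul_q (i j : Fin n) :
    p K n i * q K n j = q K n j * p K n i + (if i = j then 1 else 0) := by
  have h := RingQuot.mkAlgHom_rel K (WeylRel.pq (K := K) i j)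
  rw [map_sub, map_mul, map_mul, sub_eq_iff_eq_add] at h
  rw [add_comm]
  refine h.trans ?_
  split_ifs <;> simp [p, q]

theorem q_comm (i j : Fin n) : q K n i * q K n j = q K n j * q K n i := by
  have h := RingQuot.mkAlgHom_rel K (WeylRel.qq (K := K) i j)
  rw [map_sub, map_mul, map_mul, map_zero, sub_eq_zero] at h
  exact h

theorem p_comm (i j : Fin n) : p K n i * p K n j = p K n j * p K n i := by
  have h := RingQuot.mkAlgHom_rel K (WeylRel.pp (K := K) i j)
  rw [map_sub, map_mul, map_mul, map_zero, sub_eq_zero] at h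
  exact h

theorem exists_eval {R : Type*} [Ring R] [Algebra K R] (g : Fin n → R)
    (hg : ∀ i j, g i * g j = g j * g i) :
    ∃ f : MvPolynomial (Fin n) K →ₐ[K] R, ∀ i, f (MvPolynomial.X i) = g i := by
  let S := Algebra.adjoin K (Set.range g)
  have hS : IsMulCommutative S := Algebra.isMulCommutative_adjoin K (by
    rintro _ ⟨i, rfl⟩ _ ⟨j, rfl⟩
    exact hg i j)
  let _ : CommRing S := { (inferInstance : Ring S) with mul_comm := hS.is_comm.comm }
  let f : MvPolynomial (Fin n) K →ₐ[K] S :=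
    MvPolynomial.aeval fun i => (⟨g i, Algebra.subset_adjoin ⟨i, rfl⟩⟩ : S)
  refine ⟨S.val.comp f, fun i => ?_⟩
  simp [f]

theorem eval_monomial {R : Type*} [Semiring R] [Algebra K R]
    (f : MvPolynomial (Fin n) K →ₐ[K] R) (a : Fin n →₀ ℕ) :
    f (MvPolynomial.monomial a 1) = (List.ofFn fun i => f (MvPolynomial.X i) ^ a i).prod := by
  rw [MvPolynomial.monomial_eq, map_one, one_mul, Finsupp.prod_fintype _ _ (by simp),
    ← List.prod_ofFn, map_list_prod, List.map_ofFn]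
  congr 2
  ext i
  simp

/-- Evaluation at the commuting elements `q i`. -/
def evalQ : MvPolynomial (Fin n) K →ₐ[K] WeylAlgebra K n :=
  (exists_eval K n (q K n) (q_comm K n)).choose

/-- Evaluation at the commuting elements `p i`. -/
def evalP : MvPolynomial (Fin n) K →ₐ[K] WeylAlgebra K n :=
  (exists_eval K n (p K n) (p_comm K n)).choose

@[simp] theorem evalQ_X (i : Fin n) : evalQ K n (MvPolynomial.X i) = q K n i :=
  (exists_eval K n (q K n) (q_comm K n)).choose_spec i

@[simp] theorem evalP_X (i : Fin n) : evalP K n (MvPolynomial.X i) = p K n i :=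
  (exists_eval K n (p K n) (p_comm K n)).choose_spec i

theorem p_mul_evalQ (i : Fin n) (f : MvPolynomial (Fin n) K) :
    p K n i * evalQ K n f = evalQ K n f * p K n i + evalQ K n (MvPolynomial.pderiv i f) := by
  induction f using MvPolynomial.induction_on with
  | C a =>
    rw [MvPolynomial.pderiv_C, map_zero, add_zero, ← MvPolynomial.algebraMap_eq, AlgHom.commutes,
      Algebra.commutes]
  | add f g hf hg =>
    simp only [map_add, mul_add, add_mul, hf, hg]
    abel
  | mul_X f j hf =>
    rw [Derivation.leibniz, map_mul, evalQ_X, ← mul_assoc, hf, add_mul, mul_assoc, p_mul_q,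
      MvPolynomial.pderiv_X, map_add, smul_eq_mul, smul_eq_mul, map_mul, map_mul, evalQ_X]
    have hc : q K n j * evalQ K n (MvPolynomial.pderiv i f)
        = evalQ K n (MvPolynomial.pderiv i f) * q K n j := by
      rw [← evalQ_X, ← map_mul, ← map_mul, mul_comm]
    rw [hc, mul_add, ← mul_assoc, add_assoc]
    congr 2
    by_cases h : i = j
    · subst h
      simp
    · rw [if_neg h, Pi.single_eq_of_ne (Ne.symm h)]
      simp

/-- The normal ordering map `f ⊗ g ↦ f(q) g(p)`. -/
def normalOrder : MvPolynomial (Fin n) K ⊗[K] MvPolynomial (Fin n) K →ₗ[K] WeylAlgebra K n :=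
  TensorProduct.lift ((LinearMap.mul K (WeylAlgebra K n)).compl₁₂
    (evalQ K n).toLinearMap (evalP K n).toLinearMap)

@[simp] theorem normalOrder_tmul (f g : MvPolynomial (Fin n) K) :
    normalOrder K n (f ⊗ₜ g) = evalQ K n f * evalP K n g := by
  simp [normalOrder]

/-- The operators by which the generators act on normally ordered symbols. -/
def symGen : Fin n ⊕ Fin n →
    Module.End K (MvPolynomial (Fin n) K ⊗[K] MvPolynomial (Fin n) K)
  | Sum.inl i => TensorProduct.map (LinearMap.mulLeft K (MvPolynomial.X i)) LinearMap.id
  | Sum.inr i => TensorProduct.map LinearMap.id (LinearMap.mulLeft K (MvPolynomial.X i))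
      + TensorProduct.map (MvPolynomial.pderiv i).toLinearMap LinearMap.id

@[simp] theorem symGen_inl (i : Fin n) (f g : MvPolynomial (Fin n) K) :
    symGen K n (Sum.inl i) (f ⊗ₜ g) = (MvPolynomial.X i * f) ⊗ₜ g := by
  simp [symGen]

@[simp] theorem symGen_inr (i : Fin n) (f g : MvPolynomial (Fin n) K) :
    symGen K n (Sum.inr i) (f ⊗ₜ g)
      = f ⊗ₜ (MvPolynomial.X i * g) + (MvPolynomial.pderiv i f) ⊗ₜ g := by
  simp [symGen]

theorem pderiv_comm' (i j : Fin n) (f : MvPolynomial (Fin n) K) :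
    MvPolynomial.pderiv i (MvPolynomial.pderiv j f)
      = MvPolynomial.pderiv j (MvPolynomial.pderiv i f) := by
  have h : ⁅(MvPolynomial.pderiv i : Derivation K (MvPolynomial (Fin n) K) _),
      (MvPolynomial.pderiv j : Derivation K (MvPolynomial (Fin n) K) _)⁆ = 0 := by
    apply MvPolynomial.derivation_ext
    intro k
    rw [Derivation.commutator_apply, MvPolynomial.pderiv_X, MvPolynomial.pderiv_X]
    by_cases h1 : j = k <;> by_cases h2 : i = k <;>
      simp [h1, h2, eq_comm]
  have h2 := DFunLike.congr_fun h f
  rw [Derivation.commutator_apply] at h2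
  exact sub_eq_zero.mp h2

/-- The representation of the Weyl algebra on normally ordered symbols. -/
def symRep : WeylAlgebra K n →ₐ[K]
    Module.End K (MvPolynomial (Fin n) K ⊗[K] MvPolynomial (Fin n) K) :=
  RingQuot.liftAlgHom K ⟨FreeAlgebra.lift K (symGen K n), by
    rintro _ _ (⟨i, j⟩ | ⟨i, j⟩ | ⟨i, j⟩)
    · apply TensorProduct.ext'
      intro f g
      by_cases h : i = j
      · subst h
        simp [Derivation.leibniz, TensorProduct.add_tmul]
      · simp [Derivation.leibniz, h, MvPolynomial.pderiv_X]
    · apply TensorProduct.ext'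
      intro f g
      simp [mul_left_comm]
    · apply TensorProduct.ext'
      intro f g
      simp only [map_sub, map_mul, FreeAlgebra.lift_ι_apply, LinearMap.sub_apply,
        Module.End.mul_apply, symGen_inr, map_add, map_zero, LinearMap.zero_apply,
        mul_left_comm (MvPolynomial.X i) (MvPolynomial.X j) g, pderiv_comm' K n i j]
      abel⟩

@[simp] theorem symRep_q (i : Fin n) : symRep K n (q K n i) = symGen K n (Sum.inl i) := by
  simp [symRep, q]

@[simp] theorem symRep_p (i : Fin n) : symRep K n (p K n i) = symGen K n (Sum.inr i) := by
  simp [symRep, p]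

theorem normalOrder_symGen (k : Fin n ⊕ Fin n)
    (t : MvPolynomial (Fin n) K ⊗[K] MvPolynomial (Fin n) K) :
    normalOrder K n (symGen K n k t)
      = RingQuot.mkAlgHom K (WeylRel K n) (FreeAlgebra.ι K k) * normalOrder K n t := by
  induction t using TensorProduct.induction_on with
  | zero => simp
  | add x y hx hy => simp only [map_add, hx, hy, mul_add]
  | tmul f g =>
    rcases k with i | i
    · change _ = q K n i * _
      simp [mul_assoc]
    · change _ = p K n i * _
      rw [symGen_inr, map_add, normalOrder_tmul, normalOrder_tmul, normalOrder_tmul, map_mul,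
        evalP_X, ← mul_assoc (p K n i), p_mul_evalQ, add_mul, mul_assoc]

theorem normalOrder_symRep (w : WeylAlgebra K n)
    (t : MvPolynomial (Fin n) K ⊗[K] MvPolynomial (Fin n) K) :
    normalOrder K n (symRep K n w t) = w * normalOrder K n t := by
  obtain ⟨w, rfl⟩ := RingQuot.mkAlgHom_surjective K (WeylRel K n) w
  induction w using FreeAlgebra.induction generalizing t with
  | grade0 r => simp [Algebra.smul_def]
  | grade1 k =>
    rw [← normalOrder_symGen]
    simp [symRep]
  | mul a b ha hb => rw [map_mul, map_mul, Module.End.mul_apply, ha, hb, mul_assoc]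
  | add a b ha hb => simp only [map_add, LinearMap.add_apply, ha, hb, add_mul]

theorem symRep_evalQ (f h g : MvPolynomial (Fin n) K) :
    symRep K n (evalQ K n f) (h ⊗ₜ g) = (f * h) ⊗ₜ g := by
  induction f using MvPolynomial.induction_on generalizing h with
  | C a =>
    rw [← MvPolynomial.algebraMap_eq, AlgHom.commutes, AlgHom.commutes,
      Module.algebraMap_end_apply, TensorProduct.smul_tmul', Algebra.smul_def]
  | add f g hf hg => simp only [map_add, LinearMap.add_apply, hf, hg, add_mul,
      TensorProduct.add_tmul]
  | mul_X f j hf =>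
    rw [map_mul, map_mul, Module.End.mul_apply, evalQ_X, symRep_q, symGen_inl, hf, mul_assoc]

theorem symRep_evalP (f g : MvPolynomial (Fin n) K) :
    symRep K n (evalP K n f) (1 ⊗ₜ g) = 1 ⊗ₜ (f * g) := by
  induction f using MvPolynomial.induction_on generalizing g with
  | C a =>
    rw [← MvPolynomial.algebraMap_eq, AlgHom.commutes, AlgHom.commutes,
      Module.algebraMap_end_apply, ← TensorProduct.tmul_smul, Algebra.smul_def]
  | add f g hf hg => simp only [map_add, LinearMap.add_apply, hf, hg, add_mul,
      TensorProduct.tmul_add]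
  | mul_X f j hf =>
    rw [map_mul, map_mul, Module.End.mul_apply, evalP_X, symRep_p, symGen_inr, map_add, hf,
      mul_assoc]
    simp

/-- Normal ordering is a linear isomorphism. -/
def normalOrderEquiv :
    (MvPolynomial (Fin n) K ⊗[K] MvPolynomial (Fin n) K) ≃ₗ[K] WeylAlgebra K n :=
  LinearEquiv.ofLinearMap (normalOrder K n)
    ((LinearMap.applyₗ (1 ⊗ₜ 1)).comp (symRep K n).toLinearMap)
    (by
      ext w
      simp [normalOrder_symRep])
    (by
      apply TensorProduct.ext'
      intro f g
      simp [symRep_evalP, symRep_evalQ])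

/-- Exponent vectors, split along the three groups of generators. -/
def expEquiv : (((Fin n →₀ ℕ) × (Fin n →₀ ℕ)) × (Fin m →₀ ℕ)) ≃ (Idx n m →₀ ℕ) :=
  (Equiv.prodCongr Finsupp.sumFinsuppEquivProdFinsupp.symm (Equiv.refl _)).trans
    Finsupp.sumFinsuppEquivProdFinsupp.symm

/-- The basis of `A_n ⊗ P_m` consisting of the ordered monomials, see `stdBasis_apply`. -/
def stdBasis : Module.Basis (Idx n m →₀ ℕ) K (WeylPolyAlgebra K n m) :=
  ((((MvPolynomial.basisMonomials (Fin n) K).tensorProduct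
    (MvPolynomial.basisMonomials (Fin n) K)).map (normalOrderEquiv K n)).tensorProduct
    (MvPolynomial.basisMonomials (Fin m) K)).reindex (expEquiv n m)

theorem stdBasis_apply (α : Idx n m →₀ ℕ) : stdBasis K n m α = stdMonomial K n m α := by
  have h1 : ∀ (f : Fin n → WeylAlgebra K n) (a : Fin n → ℕ),
      (List.ofFn fun i => (f i ⊗ₜ[K] (1 : MvPolynomial (Fin m) K)) ^ a i).prod
        = (List.ofFn fun i => f i ^ a i).prod ⊗ₜ[K] (1 : MvPolynomial (Fin m) K) := by
    intro f a
    have := map_list_prod (Algebra.TensorProduct.includeLeft :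
      WeylAlgebra K n →ₐ[K] WeylPolyAlgebra K n m) (List.ofFn fun i => f i ^ a i)
    rw [Algebra.TensorProduct.includeLeft_apply] at this
    rw [this, List.map_ofFn]
    congr 2
    ext i
    simp
  have h2 : ∀ c : Fin m →₀ ℕ,
      (List.ofFn fun j => ((1 : WeylAlgebra K n) ⊗ₜ[K]
        (MvPolynomial.X j : MvPolynomial (Fin m) K)) ^ c j).prod
        = (1 : WeylAlgebra K n) ⊗ₜ[K] MvPolynomial.monomial c (1 : K) := by
    intro c
    exact (eval_monomial K m (Algebra.TensorProduct.includeRight :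
      MvPolynomial (Fin m) K →ₐ[K] WeylPolyAlgebra K n m) c).symm
  obtain ⟨⟨⟨a, b⟩, c⟩, rfl⟩ := (expEquiv n m).surjective α
  have hL : stdBasis K n m (expEquiv n m ((a, b), c))
      = (evalQ K n (MvPolynomial.monomial a 1) * evalP K n (MvPolynomial.monomial b 1))
        ⊗ₜ[K] MvPolynomial.monomial c (1 : K) := by
    simp [stdBasis, normalOrderEquiv, Module.Basis.tensorProduct_apply]
  have ha : ∀ i, expEquiv n m ((a, b), c) (Sum.inl (Sum.inl i)) = a i := fun i => rfl
  have hb : ∀ i, expEquiv n m ((a, b), c) (Sum.inl (Sum.inr i)) = b i := fun i => rfl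
  have hc : ∀ j, expEquiv n m ((a, b), c) (Sum.inr j) = c j := fun j => rfl
  rw [hL, stdMonomial]
  simp only [ha, hb, hc, gen, h1, h2, eval_monomial, evalQ_X, evalP_X,
    Algebra.TensorProduct.tmul_mul_tmul, mul_one, one_mul]

/-! Degrees. -/

variable {K n m}

/-- The degree `max {|α| : λ_α ≠ 0}` of `a = ∑ λ_α x ^ α`. -/
def deg (a : WeylPolyAlgebra K n m) : ℕ :=
  ((stdBasis K n m).repr a).support.sup fun α => ∑ i, α i

/-- The degree `max {deg σ(x_i)}` of an algebra automorphism `σ`. -/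
def autDeg (σ : WeylPolyAlgebra K n m ≃ₐ[K] WeylPolyAlgebra K n m) : ℕ :=
  Finset.univ.sup fun i : Idx n m => deg (σ (gen K n m i))

end WeylPoly

end

/-! The proof compares Hilbert functions. Write A for the algebra, A_{<k} for its elements of degree
less than k, s = 2n+m, d = deg σ, x = x_i, g = σ⁻¹(x) and e = deg g. The automorphism carries A/Ag
onto A/Ax. The first quotient grows like e · k^(s-1)/(s-1)!, the second like that of a hyperplane,
and σ stretches degrees by at most the factor d; hence e ≤ d^(s-1).

Concretely, V = σ(A_{<k+1}) and W = A_{<dk} · x both lie in A_{<dk+1}. If σ(f) = h x, then f =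
σ⁻¹(h) g. Since degrees add under multiplication, σ⁻¹(h) lies in A_{<k+1-e}, which bounds dim(V ∩
W). The dimension formula then gives dim A_{<k+1} - dim A_{<k+1-e} ≤ dim A_{<dk+1} - dim A_{<dk}
(`finrank_degreeLT_add_le`). The left side consists of e layers and the right side of one; letting k
tend to infinity compares the leading coefficients.

Noncommutativity enters only through `symbol_mul_sub_mem`: the product of A agrees with that of the
polynomial ring up to lower degree. So degrees add, as in a domain, and dimensions can be counted on
polynomials. -/

/-! ### Polynomials of bounded degree and their dimensions. -/

namespace MvPolynomial

variable {K ι : Type*} [Field K]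

/-- The polynomials of total degree less than `k`. -/
noncomputable def degreeLT (K ι : Type*) [Field K] (k : ℕ) : Submodule K (MvPolynomial ι K) :=
  restrictSupport K {α | α.degree < k}

theorem mem_degreeLT {k : ℕ} {f : MvPolynomial ι K} :
    f ∈ degreeLT K ι k ↔ ∀ α ∈ f.support, α.degree < k :=
  Iff.rfl

theorem degreeLT_mono {j k : ℕ} (h : j ≤ k) : degreeLT K ι j ≤ degreeLT K ι k :=
  restrictSupport_mono K fun _ hα => lt_of_lt_of_le hα h

theorem mul_mem_degreeLT {j k : ℕ} {f g : MvPolynomial ι K} (hf : f ∈ degreeLT K ι (j + 1))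
    (hg : g ∈ degreeLT K ι k) : f * g ∈ degreeLT K ι (j + k) := by
  classical
  intro α hα
  obtain ⟨β, hβ, γ, hγ, rfl⟩ := Finset.mem_add.mp (support_mul f g hα)
  have h1 := mem_degreeLT.mp hf β hβ
  have h2 := mem_degreeLT.mp hg γ hγ
  change (β + γ).degree < j + k
  rw [map_add]
  omega

theorem one_mem_degreeLT {k : ℕ} : (1 : MvPolynomial ι K) ∈ degreeLT K ι (k + 1) := by
  refine (monomial_mem_restrictSupport K).mpr (Or.inl ?_)
  simp

theorem X_mem_degreeLT (i : ι) : (X i : MvPolynomial ι K) ∈ degreeLT K ι 2 := by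
  refine (monomial_mem_restrictSupport K).mpr (Or.inl ?_)
  simp [Finsupp.degree_single]

theorem pderiv_mem_degreeLT (i : ι) {k : ℕ} {f : MvPolynomial ι K}
    (hf : f ∈ degreeLT K ι (k + 1)) : pderiv i f ∈ degreeLT K ι k := by
  classical
  rw [degreeLT, restrictSupport_eq_span] at hf
  induction hf using Submodule.span_induction with
  | zero => simp
  | add f g _ _ hf hg => rw [map_add]; exact add_mem hf hg
  | smul c f _ hf => rw [Derivation.map_smul]; exact Submodule.smul_mem _ _ hf
  | mem f hf =>
    obtain ⟨α, hα, rfl⟩ := hf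
    change α.degree < k + 1 at hα
    simp only [pderiv_monomial, one_mul]
    refine (monomial_mem_restrictSupport K).mpr ?_
    by_cases h : α i = 0
    · right
      simp [h]
    · left
      have h1 : α - Finsupp.single i 1 + Finsupp.single i 1 = α :=
        tsub_add_cancel_of_le (by simpa [Nat.one_le_iff_ne_zero] using h)
      have h2 := congrArg Finsupp.degree h1
      rw [map_add, Finsupp.degree_single] at h2
      change (α - Finsupp.single i 1).degree < k
      omega

theorem totalDegree_lt_of_mem_degreeLT {k : ℕ} {f : MvPolynomial ι K} (hf : f ∈ degreeLT K ι k)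
    (h : f ≠ 0) : f.totalDegree < k := by
  obtain ⟨α, hα, h1⟩ := Finset.exists_mem_eq_sup _ (support_nonempty.mpr h)
    fun s : ι →₀ ℕ => s.sum fun _ e => e
  rw [totalDegree, h1]
  exact hf hα

theorem mem_degreeLT_of_totalDegree_lt {k : ℕ} {f : MvPolynomial ι K} (h : f.totalDegree < k) :
    f ∈ degreeLT K ι k :=
  fun _ hα => (le_totalDegree hα).trans_lt h

theorem finrank_degreeLT (k : ℕ) :
    Module.finrank K (degreeLT K ι k) = Set.ncard {α : ι →₀ ℕ | α.degree < k} := by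
  rw [degreeLT, Module.finrank_eq_nat_card_basis (basisRestrictSupport K _),
    Nat.card_coe_set_eq]

section Dimension

variable [Fintype ι]

instance finiteDimensional_degreeLT (k : ℕ) : FiniteDimensional K (degreeLT K ι k) := by
  have : Finite {α : ι →₀ ℕ | α.degree < k} :=
    (Finsupp.finite_of_degree_le k).subset fun _ (h : _ < k) => h.le
  exact Module.Finite.of_basis (basisRestrictSupport K {α : ι →₀ ℕ | α.degree < k})

/-- The increment counts the monomials of degree exactly k, by stars and bars. -/
theorem finrank_degreeLT_succ (k : ℕ) :
    Module.finrank K (degreeLT K ι (k + 1))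
      = Module.finrank K (degreeLT K ι k) + (Fintype.card ι + k - 1).choose k := by
  classical
  have hf : ∀ j, {α : ι →₀ ℕ | α.degree < j}.Finite := fun j =>
    (Finsupp.finite_of_degree_le j).subset fun _ (h : _ < j) => h.le
  have hc : ((Finset.univ : Finset ι).finsuppAntidiag k : Set (ι →₀ ℕ)) = {α | α.degree = k} := by
    ext α
    simp [Finset.mem_finsuppAntidiag, Finsupp.degree_eq_sum]
  have hu : {α : ι →₀ ℕ | α.degree < k + 1} = {α | α.degree < k} ∪ {α | α.degree = k} := by
    ext α
    exact Nat.lt_succ_iff_lt_or_eq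
  have hd : Disjoint {α : ι →₀ ℕ | α.degree < k} {α | α.degree = k} :=
    Set.disjoint_left.mpr fun _ h1 h2 => h1.ne h2
  rw [finrank_degreeLT, finrank_degreeLT, hu,
    Set.ncard_union_eq hd (hf k) (hc ▸ Finset.finite_toSet _), ← hc,
    Set.ncard_coe_finset, Finset.card_finsuppAntidiag_nat_eq_choose, Finset.card_univ]

end Dimension

end MvPolynomial

/-! ### Comparison of leading coefficients. -/

theorem Nat.le_pow_of_forall_mul_pow_le {e d c r : ℕ}
    (h : ∀ t : ℕ, e * (t + 1) ^ r ≤ (d * t + c) ^ r) : e ≤ d ^ r := by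
  -- Divide the inequality by (t + 1)^r: the right side becomes ((d t + c)/(t + 1))^r, with limit
  -- d^r.
  have h1 : Filter.Tendsto (fun t : ℕ => (((d : ℝ) * t + c) / (1 * t + 1)) ^ r) Filter.atTop
      (nhds (((d : ℝ) / 1) ^ r)) :=
    (tendsto_add_mul_div_add_mul_atTop_nhds (c : ℝ) 1 d one_ne_zero |>.congr
      fun t => by ring_nf).pow r
  have h2 : (e : ℝ) ≤ ((d : ℝ) / 1) ^ r := by
    refine ge_of_tendsto' h1 fun t => ?_
    rw [div_pow, le_div_iff₀ (by positivity), one_mul]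
    exact_mod_cast h t
  rw [div_one] at h2
  exact_mod_cast h2

/-- Multiplied by r!, each binomial coefficient is a product of r consecutive integers, hence lies
between the r-th powers of its extreme factors. This reduces the claim to pure powers. -/
theorem Nat.le_pow_of_forall_mul_choose_le {e d c r : ℕ}
    (h : ∀ t : ℕ, e * (t + r).choose r ≤ (d * t + c + r).choose r) : e ≤ d ^ r := by
  refine Nat.le_pow_of_forall_mul_pow_le (c := c + r) fun t => ?_
  have h1 := Nat.pow_succ_le_ascFactorial (t + 1) r
  have h2 := Nat.ascFactorial_le_pow_add (d * t + c) r
  rw [Nat.ascFactorial_eq_factorial_mul_choose] at h1 h2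
  calc e * (t + 1) ^ r ≤ e * (r.factorial * (t + r).choose r) := by gcongr
    _ = r.factorial * (e * (t + r).choose r) := by ring
    _ ≤ r.factorial * (d * t + c + r).choose r := by gcongr; exact h t
    _ ≤ _ := by rwa [← add_assoc]

/-! ### Symbols and left multiplication by generators. -/

namespace WeylPoly

open MvPolynomial (degreeLT)

variable {K : Type*} [Field K] {n m : ℕ}

/-- The symbol of an element: ordered monomials are sent to the corresponding commutative ones. -/
noncomputable def symbol : WeylPolyAlgebra K n m ≃ₗ[K] MvPolynomial (Idx n m) K :=
  (stdBasis K n m).equiv (MvPolynomial.basisMonomials (Idx n m) K) (Equiv.refl _)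

theorem symbol_stdBasis (α : Idx n m →₀ ℕ) :
    symbol (stdBasis K n m α) = MvPolynomial.monomial α 1 := by
  simp [symbol]

theorem deg_eq_totalDegree (a : WeylPolyAlgebra K n m) : deg a = (symbol a).totalDegree := by
  have h : ∀ α, ((symbol a).coeff α) = (stdBasis K n m).repr a α := by
    intro α
    change (MvPolynomial.basisMonomials (Idx n m) K).repr (symbol a) α = _
    simp only [symbol, Module.Basis.equiv, LinearEquiv.trans_apply]
    rfl
  have hs : (symbol a).support = ((stdBasis K n m).repr a).support := by
    ext α
    rw [MvPolynomial.mem_support_iff, h, Finsupp.mem_support_iff]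
  rw [deg, MvPolynomial.totalDegree, hs]
  congr 1
  ext α
  rw [Finsupp.sum_fintype _ _ fun _ => rfl]

/-- The correction to the symbol in left multiplication by a generator. -/
noncomputable def symbolDeriv :
    Idx n m → MvPolynomial (Idx n m) K →ₗ[K] MvPolynomial (Idx n m) K
  | Sum.inl (Sum.inr i) => (MvPolynomial.pderiv (Sum.inl (Sum.inl i))).toLinearMap
  | _ => 0

theorem symbolDeriv_mem_degreeLT (i : Idx n m) {k : ℕ} {f : MvPolynomial (Idx n m) K}
    (hf : f ∈ degreeLT K (Idx n m) (k + 1)) : symbolDeriv i f ∈ degreeLT K (Idx n m) k := by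
  rcases i with (i | i) | i
  · exact zero_mem _
  · exact MvPolynomial.pderiv_mem_degreeLT _ hf
  · exact zero_mem _

theorem stdBasis_expEquiv (a b : Fin n →₀ ℕ) (c : Fin m →₀ ℕ) :
    stdBasis K n m (expEquiv n m ((a, b), c))
      = (evalQ K n (MvPolynomial.monomial a 1) * evalP K n (MvPolynomial.monomial b 1))
        ⊗ₜ[K] MvPolynomial.monomial c (1 : K) := by
  simp [stdBasis, normalOrderEquiv, Module.Basis.tensorProduct_apply]

theorem symbol_tmul (a b : Fin n →₀ ℕ) (c : Fin m →₀ ℕ) :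
    symbol ((evalQ K n (MvPolynomial.monomial a 1) * evalP K n (MvPolynomial.monomial b 1))
        ⊗ₜ[K] MvPolynomial.monomial c (1 : K))
      = MvPolynomial.monomial (expEquiv n m ((a, b), c)) 1 := by
  rw [← stdBasis_expEquiv, symbol_stdBasis]

/-- Only p_i has to be moved to reach its ordered place, and passing it through f(q) leaves the
extra term ∂f/∂q_i. This is the only explicit product formula needed; general products follow by
induction over generators. -/
theorem symbol_gen_mul (i : Idx n m) (a : WeylPolyAlgebra K n m) :
    symbol (gen K n m i * a) = MvPolynomial.X i * symbol a + symbolDeriv i (symbol a) := by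
  suffices h : symbol.toLinearMap ∘ₗ LinearMap.mulLeft K (gen K n m i)
      = (LinearMap.mulLeft K (MvPolynomial.X i) + symbolDeriv i) ∘ₗ symbol.toLinearMap from
    LinearMap.congr_fun h a
  refine (stdBasis K n m).ext fun α => ?_
  obtain ⟨⟨⟨a, b⟩, c⟩, rfl⟩ := (expEquiv n m).surjective α
  simp only [LinearMap.comp_apply, LinearMap.mulLeft_apply, LinearMap.add_apply,
    LinearEquiv.coe_coe, symbol_stdBasis]
  have hX : ∀ (k : ℕ) (i : Fin k) (a : Fin k →₀ ℕ),
      (MvPolynomial.X i * MvPolynomial.monomial a 1 : MvPolynomial (Fin k) K)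
        = MvPolynomial.monomial (Finsupp.single i 1 + a) 1 := by
    intro k i a
    rw [MvPolynomial.X, MvPolynomial.monomial_mul, one_mul]
  rw [MvPolynomial.X, MvPolynomial.monomial_mul, one_mul, stdBasis_expEquiv]
  rcases i with (i | i) | i
  · rw [gen, Algebra.TensorProduct.tmul_mul_tmul, one_mul, ← mul_assoc, ← evalQ_X, ← map_mul, hX,
      symbol_tmul]
    simp only [symbolDeriv, LinearMap.zero_apply, add_zero]
    congr 2
    ext ((j | j) | j) <;> simp [expEquiv, Finsupp.single_apply]
  · rw [gen, Algebra.TensorProduct.tmul_mul_tmul, one_mul, ← mul_assoc, p_mul_evalQ, add_mul,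
      mul_assoc, ← evalP_X, ← map_mul, hX, TensorProduct.add_tmul, map_add, symbol_tmul]
    congr 1
    · congr 2
      ext ((j | j) | j) <;> simp [expEquiv, Finsupp.single_apply]
    · have hs : ∀ (f : Fin n →₀ ℕ) (r : K), evalQ K n (MvPolynomial.monomial f r)
          = r • evalQ K n (MvPolynomial.monomial f 1) := by
        intro f r
        rw [← map_smul, MvPolynomial.smul_monomial, smul_eq_mul, mul_one]
      change _ = MvPolynomial.pderiv (Sum.inl (Sum.inl i)) _
      rw [MvPolynomial.pderiv_monomial, MvPolynomial.pderiv_monomial, hs, smul_mul_assoc,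
        ← TensorProduct.smul_tmul', map_smul, symbol_tmul, MvPolynomial.smul_monomial, smul_eq_mul]
      have he : expEquiv n m ((a - Finsupp.single i 1, b), c)
          = expEquiv n m ((a, b), c) - Finsupp.single (Sum.inl (Sum.inl i)) 1 := by
        ext ((j | j) | j) <;> simp [expEquiv, Finsupp.single_apply]
      rw [he]
      simp [expEquiv]
  · rw [gen, Algebra.TensorProduct.tmul_mul_tmul, one_mul, hX, symbol_tmul]
    simp only [symbolDeriv, LinearMap.zero_apply, add_zero]
    congr 2
    ext ((j | j) | j) <;> simp [expEquiv, Finsupp.single_apply]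

theorem symbol_one : symbol (1 : WeylPolyAlgebra K n m) = 1 := by
  have h := symbol_tmul (K := K) (0 : Fin n →₀ ℕ) 0 (0 : Fin m →₀ ℕ)
  have he : expEquiv n m ((0, 0), 0) = 0 := by
    ext ((j | j) | j) <;> simp [expEquiv]
  rw [he] at h
  simpa [Algebra.TensorProduct.one_def] using h

/-! ### The degree filtration and additivity of degrees. -/

/-- The elements of degree less than `k`. -/
noncomputable def degLT (K : Type*) [Field K] (n m k : ℕ) :
    Submodule K (WeylPolyAlgebra K n m) :=
  (degreeLT K (Idx n m) k).comap symbol.toLinearMap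

theorem mem_degLT {k : ℕ} {a : WeylPolyAlgebra K n m} :
    a ∈ degLT K n m k ↔ symbol a ∈ degreeLT K (Idx n m) k :=
  Iff.rfl

theorem deg_lt_of_mem_degLT {k : ℕ} {a : WeylPolyAlgebra K n m} (ha : a ∈ degLT K n m k)
    (h : a ≠ 0) : deg a < k := by
  rw [deg_eq_totalDegree]
  exact MvPolynomial.totalDegree_lt_of_mem_degreeLT ha (by simpa using h)

theorem mem_degLT_of_deg_lt {k : ℕ} {a : WeylPolyAlgebra K n m} (h : deg a < k) :
    a ∈ degLT K n m k :=
  mem_degLT.mpr (MvPolynomial.mem_degreeLT_of_totalDegree_lt (by rwa [← deg_eq_totalDegree]))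

theorem one_mem_degLT {k : ℕ} : (1 : WeylPolyAlgebra K n m) ∈ degLT K n m (k + 1) := by
  rw [mem_degLT, symbol_one]
  exact MvPolynomial.one_mem_degreeLT

theorem degLT_mono {j k : ℕ} (h : j ≤ k) : degLT K n m j ≤ degLT K n m k :=
  Submodule.comap_mono (MvPolynomial.degreeLT_mono h)

/-- A filtration that contains `1` and is compatible with left multiplication by the generators
dominates the filtration by degree. -/
theorem degLT_le_of_gen_mul_mem (T : ℕ → Submodule K (WeylPolyAlgebra K n m)) (hT : Monotone T)
    (h1 : 1 ∈ T 0) (hg : ∀ i k, ∀ a ∈ T k, gen K n m i * a ∈ T (k + 1)) (k : ℕ) :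
    degLT K n m (k + 1) ≤ T k := by
  induction k with
  | zero =>
    intro a ha
    have h2 : symbol a = MvPolynomial.C ((symbol a).coeff 0) := by
      rw [← MvPolynomial.totalDegree_eq_zero_iff_eq_C, ← deg_eq_totalDegree]
      by_cases h : a = 0
      · simp [h, deg]
      · exact Nat.lt_one_iff.mp (deg_lt_of_mem_degLT ha h)
    have h3 : a = ((symbol a).coeff 0) • (1 : WeylPolyAlgebra K n m) := by
      apply symbol.injective
      rw [map_smul, symbol_one, MvPolynomial.smul_eq_C_mul, mul_one, ← h2]
    rw [h3]
    exact Submodule.smul_mem _ _ h1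
  | succ k ih =>
    suffices h : degreeLT K (Idx n m) (k + 1 + 1) ≤ (T (k + 1)).comap symbol.symm.toLinearMap by
      intro a ha
      simpa using h ha
    rw [degreeLT, MvPolynomial.restrictSupport_eq_span, Submodule.span_le]
    rintro _ ⟨α, hα, rfl⟩
    change α.degree < k + 1 + 1 at hα
    change symbol.symm (MvPolynomial.monomial α 1) ∈ T (k + 1)
    by_cases h0 : α = 0
    · subst h0
      have : symbol.symm (MvPolynomial.monomial (0 : Idx n m →₀ ℕ) (1 : K)) = 1 := by
        rw [LinearEquiv.symm_apply_eq, symbol_one]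
        rfl
      rw [this]
      exact hT (Nat.zero_le _) h1
    · obtain ⟨i, hi⟩ := Finsupp.ne_iff.mp h0
      have h4 : Finsupp.single i 1 + (α - Finsupp.single i 1) = α :=
        add_tsub_cancel_of_le (by simpa [Nat.one_le_iff_ne_zero] using hi)
      have h5 := congrArg Finsupp.degree h4
      rw [map_add, Finsupp.degree_single] at h5
      set f : MvPolynomial (Idx n m) K := MvPolynomial.monomial (α - Finsupp.single i 1) 1 with hf
      have hfm : f ∈ degreeLT K (Idx n m) (k + 1) := by
        refine (MvPolynomial.monomial_mem_restrictSupport K).mpr (Or.inl ?_)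
        change (α - Finsupp.single i 1).degree < k + 1
        omega
      -- Split off one variable occurring in the monomial. Left multiplication by its generator
      -- restores the monomial up to the correction term, whose degree is lower, so the induction
      -- hypothesis covers both pieces.
      have h6 : symbol.symm (MvPolynomial.monomial α 1)
          = gen K n m i * symbol.symm f + symbol.symm (-symbolDeriv i f) := by
        rw [LinearEquiv.symm_apply_eq, map_add, symbol_gen_mul, LinearEquiv.apply_symm_apply,
          LinearEquiv.apply_symm_apply, add_neg_cancel_right, hf, MvPolynomial.X,
          MvPolynomial.monomial_mul, h4, one_mul]
      rw [h6]
      refine add_mem (hg i k _ (ih ?_)) (hT (Nat.le_succ k) (ih ?_))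
      · rw [mem_degLT, LinearEquiv.apply_symm_apply]
        exact hfm
      · rw [mem_degLT, LinearEquiv.apply_symm_apply]
        exact neg_mem (MvPolynomial.degreeLT_mono (Nat.le_succ k) (symbolDeriv_mem_degreeLT i hfm))

theorem gen_mul_mem_degLT (i : Idx n m) {k : ℕ} {a : WeylPolyAlgebra K n m}
    (ha : a ∈ degLT K n m k) : gen K n m i * a ∈ degLT K n m (k + 1) := by
  rw [mem_degLT, symbol_gen_mul]
  refine add_mem ?_ (MvPolynomial.degreeLT_mono (Nat.le_succ k)
    (symbolDeriv_mem_degreeLT i (MvPolynomial.degreeLT_mono (Nat.le_succ k) ha)))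
  rw [add_comm k]
  exact MvPolynomial.mul_mem_degreeLT (MvPolynomial.X_mem_degreeLT i) ha

/-- Up to terms of lower degree the symbol is multiplicative. -/
theorem symbol_mul_sub_mem {j k : ℕ} {a b : WeylPolyAlgebra K n m}
    (ha : a ∈ degLT K n m (j + 1)) (hb : b ∈ degLT K n m (k + 1)) :
    symbol (a * b) - symbol a * symbol b ∈ degreeLT K (Idx n m) (j + k) := by
  -- For fixed b, the elements a that satisfy the claim form a filtration, so it suffices to check 1
  -- and left multiplication by generators.
  let T : ℕ → Submodule K (WeylPolyAlgebra K n m) := fun j => degLT K n m (j + 1) ⊓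
    (degreeLT K (Idx n m) (j + k)).comap (symbol.toLinearMap ∘ₗ LinearMap.mulRight K b
      - LinearMap.mulRight K (symbol b) ∘ₗ symbol.toLinearMap)
  refine (degLT_le_of_gen_mul_mem T ?_ ?_ ?_ j ha).2
  · intro i j hij
    exact inf_le_inf (degLT_mono (by omega))
      (Submodule.comap_mono (MvPolynomial.degreeLT_mono (by omega)))
  · refine ⟨one_mem_degLT, ?_⟩
    change symbol (1 * b) - symbol 1 * symbol b ∈ degreeLT K (Idx n m) (0 + k)
    rw [symbol_one, one_mul, one_mul, sub_self]
    exact zero_mem _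
  · rintro i j a ⟨ha, hab⟩
    refine ⟨gen_mul_mem_degLT i ha, ?_⟩
    change symbol (a * b) - symbol a * symbol b ∈ degreeLT K (Idx n m) (j + k) at hab
    change symbol (gen K n m i * a * b) - symbol (gen K n m i * a) * symbol b
      ∈ degreeLT K (Idx n m) (j + 1 + k)
    have h1 : symbol a * symbol b ∈ degreeLT K (Idx n m) (j + (k + 1)) :=
      MvPolynomial.mul_mem_degreeLT ha hb
    have h2 : symbol (a * b) ∈ degreeLT K (Idx n m) (j + k + 1) := by
      rw [← sub_add_cancel (symbol (a * b)) (symbol a * symbol b)]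
      exact add_mem (MvPolynomial.degreeLT_mono (Nat.le_succ _) hab) h1
    have h3 : symbolDeriv i (symbol a) * symbol b ∈ degreeLT K (Idx n m) (j + 1 + k) := by
      have : symbolDeriv i (symbol a) * symbol b = symbol b * symbolDeriv i (symbol a) :=
        mul_comm _ _
      rw [this, show j + 1 + k = k + (j + 1) by ring]
      exact MvPolynomial.mul_mem_degreeLT hb
        (MvPolynomial.degreeLT_mono (Nat.le_succ j) (symbolDeriv_mem_degreeLT i ha))
    have h4 : MvPolynomial.X i * (symbol (a * b) - symbol a * symbol b)
        ∈ degreeLT K (Idx n m) (j + 1 + k) := by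
      rw [show j + 1 + k = 1 + (j + k) by ring]
      exact MvPolynomial.mul_mem_degreeLT (MvPolynomial.X_mem_degreeLT i) hab
    have h5 : symbolDeriv i (symbol (a * b)) ∈ degreeLT K (Idx n m) (j + 1 + k) :=
      MvPolynomial.degreeLT_mono (by omega) (symbolDeriv_mem_degreeLT i h2)
    rw [mul_assoc, symbol_gen_mul, symbol_gen_mul]
    -- The new error is X_i times the old one, plus the correction for a b, minus the correction for
    -- a times the symbol of b.
    convert sub_mem (add_mem h4 h5) h3 using 1
    ring

theorem mul_mem_degLT {j k : ℕ} {a b : WeylPolyAlgebra K n m}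
    (ha : a ∈ degLT K n m (j + 1)) (hb : b ∈ degLT K n m (k + 1)) :
    a * b ∈ degLT K n m (j + k + 1) := by
  rw [mem_degLT, ← sub_add_cancel (symbol (a * b)) (symbol a * symbol b)]
  exact add_mem (MvPolynomial.degreeLT_mono (Nat.le_succ _) (symbol_mul_sub_mem ha hb))
    (MvPolynomial.mul_mem_degreeLT (k := k + 1) ha hb)

/-- Polynomials over a field form a domain, so the product of the symbols has degree exactly `deg a
+ deg b`, and the lower-order error cannot cancel its top part. -/
theorem mul_notMem_degLT {a b : WeylPolyAlgebra K n m} (ha : a ≠ 0) (hb : b ≠ 0) :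
    a * b ∉ degLT K n m (deg a + deg b) := by
  intro h
  have h1 := symbol_mul_sub_mem (mem_degLT_of_deg_lt (Nat.lt_succ_self (deg a)))
    (mem_degLT_of_deg_lt (Nat.lt_succ_self (deg b)))
  have h2 : symbol a * symbol b ∈ degreeLT K (Idx n m) (deg a + deg b) := by
    rw [← sub_sub_cancel (symbol (a * b)) (symbol a * symbol b)]
    exact sub_mem h h1
  have ha' : symbol a ≠ 0 := by simpa using ha
  have hb' : symbol b ≠ 0 := by simpa using hb
  have h3 := MvPolynomial.totalDegree_lt_of_mem_degreeLT h2 (mul_ne_zero ha' hb')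
  rw [MvPolynomial.totalDegree_mul_of_isDomain ha' hb', ← deg_eq_totalDegree,
    ← deg_eq_totalDegree] at h3
  exact lt_irrefl _ h3

theorem mul_ne_zero_of_ne_zero {a b : WeylPolyAlgebra K n m} (ha : a ≠ 0) (hb : b ≠ 0) :
    a * b ≠ 0 := fun h => mul_notMem_degLT ha hb (h ▸ zero_mem _)

/-- The preimages under σ of the degree filtration, rescaled by `autDeg σ`, form a filtration closed
under the generators, because each σ(x_i) has degree at most `autDeg σ`. -/
theorem map_mem_degLT (σ : WeylPolyAlgebra K n m ≃ₐ[K] WeylPolyAlgebra K n m) {k : ℕ}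
    {a : WeylPolyAlgebra K n m} (ha : a ∈ degLT K n m (k + 1)) :
    σ a ∈ degLT K n m (autDeg σ * k + 1) := by
  refine degLT_le_of_gen_mul_mem
    (fun k => (degLT K n m (autDeg σ * k + 1)).comap σ.toLinearMap) ?_ ?_ ?_ k ha
  · intro i j hij
    exact Submodule.comap_mono (degLT_mono (by gcongr))
  · change σ 1 ∈ degLT K n m (autDeg σ * 0 + 1)
    rw [map_one]
    exact one_mem_degLT
  · intro i k a ha
    change σ (gen K n m i * a) ∈ degLT K n m (autDeg σ * (k + 1) + 1)
    rw [map_mul, mul_add, mul_one, add_comm (autDeg σ * k)]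
    refine mul_mem_degLT (mem_degLT_of_deg_lt (Nat.lt_succ_of_le ?_)) ha
    exact Finset.le_sup (f := fun i => deg (σ (gen K n m i))) (Finset.mem_univ i)

/-! ### The dimension count. -/

theorem finrank_degreeLT_idx_succ (k : ℕ) :
    Module.finrank K (degreeLT K (Idx n m) (k + 1))
      = Module.finrank K (degreeLT K (Idx n m) k) + (2 * n + m + k - 1).choose k := by
  rw [MvPolynomial.finrank_degreeLT_succ]
  simp [two_mul]

/-- There are e homogeneous layers, in degrees t, …, t + e - 1, and the smallest is the first. -/
theorem finrank_degreeLT_add_mul_le (h : 1 ≤ 2 * n + m) (t e : ℕ) :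
    Module.finrank K (degreeLT K (Idx n m) t) + e * (t + (2 * n + m - 1)).choose (2 * n + m - 1)
      ≤ Module.finrank K (degreeLT K (Idx n m) (t + e)) := by
  induction e with
  | zero => simp
  | succ e ih =>
    rw [← add_assoc t, finrank_degreeLT_idx_succ, add_mul, one_mul, ← add_assoc]
    have h1 : (2 * n + m + (t + e) - 1) = (t + e) + (2 * n + m - 1) := by omega
    rw [h1, Nat.choose_symm_add]
    exact add_le_add ih (Nat.choose_le_choose _ (by omega))

theorem gen_mem_degLT (i : Idx n m) : gen K n m i ∈ degLT K n m 2 := by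
  have h := gen_mul_mem_degLT i (one_mem_degLT (K := K) (n := n) (m := m) (k := 0))
  rwa [mul_one] at h

theorem gen_ne_zero (i : Idx n m) : gen K n m i ≠ 0 := by
  intro h
  have h1 := symbol_gen_mul i (1 : WeylPolyAlgebra K n m)
  rw [h, zero_mul, map_zero, symbol_one, mul_one] at h1
  have h2 : symbolDeriv i (1 : MvPolynomial (Idx n m) K) = 0 := by
    rcases i with (i | i) | i <;> simp [symbolDeriv]
  rw [h2, add_zero] at h1
  exact MvPolynomial.X_ne_zero i h1.symm

/-- This is the dimension formula for V and W, with V ∩ W bounded by σ(A_{<k+1-e} · g). The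
subtraction is truncated harmlessly: if e > k, the intersection is zero. -/
theorem finrank_degreeLT_add_le (σ : WeylPolyAlgebra K n m ≃ₐ[K] WeylPolyAlgebra K n m)
    (i : Idx n m) (k : ℕ) :
    Module.finrank K (degreeLT K (Idx n m) (k + 1))
        + Module.finrank K (degreeLT K (Idx n m) (autDeg σ * k))
      ≤ Module.finrank K (degreeLT K (Idx n m) (autDeg σ * k + 1))
        + Module.finrank K (degreeLT K (Idx n m) (k + 1 - deg (σ.symm (gen K n m i)))) := by
  set x := gen K n m i
  set g := σ.symm x with hg
  have hx : x ≠ 0 := gen_ne_zero i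
  have hg0 : g ≠ 0 := by simpa [hg] using hx
  let fV : MvPolynomial (Idx n m) K ≃ₗ[K] MvPolynomial (Idx n m) K :=
    symbol.symm ≪≫ₗ σ.toLinearEquiv ≪≫ₗ symbol
  let fW : MvPolynomial (Idx n m) K →ₗ[K] MvPolynomial (Idx n m) K :=
    symbol.toLinearMap ∘ₗ LinearMap.mulRight K x ∘ₗ symbol.symm.toLinearMap
  let fU : MvPolynomial (Idx n m) K →ₗ[K] MvPolynomial (Idx n m) K :=
    symbol.toLinearMap ∘ₗ LinearMap.mulRight K g ∘ₗ symbol.symm.toLinearMap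
  -- All three spaces are transported to polynomials by `symbol`, where finite dimensionality is
  -- available.
  let V := (degreeLT K (Idx n m) (k + 1)).map fV.toLinearMap
  let W := (degreeLT K (Idx n m) (autDeg σ * k)).map fW
  let U := ((degreeLT K (Idx n m) (k + 1 - deg g)).map fU).map fV.toLinearMap
  have hV : Module.finrank K V = Module.finrank K (degreeLT K (Idx n m) (k + 1)) :=
    LinearEquiv.finrank_map_eq _ _
  have hfW : Function.Injective fW := by
    refine (injective_iff_map_eq_zero fW).mpr fun f hf => ?_
    by_contra h
    refine mul_ne_zero_of_ne_zero (a := symbol.symm f) (by simpa using h) hx ?_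
    exact symbol.injective (hf.trans (map_zero _).symm)
  have hW : Module.finrank K W = Module.finrank K (degreeLT K (Idx n m) (autDeg σ * k)) :=
    (Submodule.equivMapOfInjective fW hfW _).finrank_eq.symm
  have hU : Module.finrank K U ≤ Module.finrank K (degreeLT K (Idx n m) (k + 1 - deg g)) :=
    (Submodule.finrank_map_le _ _).trans (Submodule.finrank_map_le _ _)
  have hsup : V ⊔ W ≤ degreeLT K (Idx n m) (autDeg σ * k + 1) := by
    refine sup_le ?_ ?_
    · rintro _ ⟨f, hf, rfl⟩
      have hf' : symbol.symm f ∈ degLT K n m (k + 1) :=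
        mem_degLT.mpr (by rwa [LinearEquiv.apply_symm_apply])
      exact map_mem_degLT σ hf'
    · rintro _ ⟨f, hf, rfl⟩
      have hf' : symbol.symm f ∈ degLT K n m (autDeg σ * k) :=
        mem_degLT.mpr (by rwa [LinearEquiv.apply_symm_apply])
      change symbol.symm f * x ∈ degLT K n m (autDeg σ * k + 1)
      -- `mul_mem_degLT` needs bounds of the form j + 1; for the bound 0 the space is zero.
      rcases Nat.eq_zero_or_pos (autDeg σ * k) with h0 | hpos
      · rw [h0] at hf'
        have : symbol.symm f = 0 := by
          by_contra h
          exact Nat.not_lt_zero _ (deg_lt_of_mem_degLT hf' h)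
        rw [this, zero_mul]
        exact zero_mem _
      · obtain ⟨j, hj⟩ := Nat.exists_eq_succ_of_ne_zero hpos.ne'
        rw [hj] at hf' ⊢
        exact mul_mem_degLT hf' (gen_mem_degLT i)
  have hinf : V ⊓ W ≤ U := by
    rintro _ ⟨⟨f, hf, rfl⟩, ⟨h, hh, hfh⟩⟩
    have hf' : symbol.symm f ∈ degLT K n m (k + 1) :=
      mem_degLT.mpr (by rwa [LinearEquiv.apply_symm_apply])
    have h1 : symbol.symm h * x = σ (symbol.symm f) := symbol.injective hfh
    set c := σ.symm (symbol.symm h) with hc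
    have h2 : symbol.symm f = c * g := by
      rw [hc, hg, ← map_mul, h1, AlgEquiv.symm_apply_apply]
    refine ⟨f, ⟨symbol c, ?_, ?_⟩, rfl⟩
    · change c ∈ degLT K n m (k + 1 - deg g)
      by_cases hc0 : c = 0
      · rw [hc0]
        exact zero_mem _
      · refine mem_degLT_of_deg_lt ?_
        by_contra hlt
        -- Otherwise deg c + deg g ≥ k + 1, while c g = σ⁻¹(h x) has degree at most k.
        refine mul_notMem_degLT hc0 hg0 (degLT_mono ?_ (h2 ▸ hf'))
        omega
    · change symbol (symbol.symm (symbol c) * g) = f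
      rw [LinearEquiv.symm_apply_apply, ← h2, LinearEquiv.apply_symm_apply]
  have h1 := Submodule.finrank_sup_add_finrank_inf_eq V W
  have h2 := Submodule.finrank_mono hsup
  have h3 := Submodule.finrank_mono hinf
  omega

end WeylPoly

open WeylPoly in
theorem theorem3p3 {K : Type*} [Field K] [CharZero K] (n m : ℕ)
    (σ : WeylPoly.WeylPolyAlgebra K n m ≃ₐ[K] WeylPoly.WeylPolyAlgebra K n m) :
    WeylPoly.autDeg σ⁻¹ ≤ WeylPoly.autDeg σ ^ (2 * n + m - 1) := by
  refine Finset.sup_le fun i _ => ?_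
  change deg (σ.symm (gen K n m i)) ≤ _
  have hs : 1 ≤ 2 * n + m := by
    rcases i with (i | i) | i <;> have := i.pos <;> omega
  set e := deg (σ.symm (gen K n m i)) with he
  rcases Nat.eq_zero_or_pos e with h0 | hpos
  · rw [h0]
    exact Nat.zero_le _
  -- Take k = t + (e - 1), so that k + 1 - e = t, which uses e > 0. Then d k = d t + d (e - 1),
  -- whence the constant c.
  refine Nat.le_pow_of_forall_mul_choose_le (c := autDeg σ * (e - 1)) fun t => ?_
  have h1 := finrank_degreeLT_add_le σ i (t + (e - 1))
  have h2 := finrank_degreeLT_add_mul_le (K := K) hs t e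
  rw [← he, show t + (e - 1) + 1 = t + e by omega, Nat.add_sub_cancel, finrank_degreeLT_idx_succ,
    show 2 * n + m + autDeg σ * (t + (e - 1)) - 1
      = autDeg σ * (t + (e - 1)) + (2 * n + m - 1) by omega, Nat.choose_symm_add, mul_add] at h1
  omega
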